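/- Let $0<p\le 1$ be a constant. For an integer $n\ge 2$ let $M=(m_{ij})$ be the $n\times n$ matrix with $m_{ij}=p$ if $i\ne j$ and $|i-j|\le n/2$, and $m_{ij}=0$ otherwise. Let $\widehat M$ be the adjacency matrix of the random linear graph, that is, of the random simple graph on $\{1,\dots,n\}$ in which the pairs $i<j$ are joined by an edge independently, with probability $m_{ij}$. For a real symmetric matrix let $\lambda_2$ denote its second largest eigenvalue, counted with multiplicity. Then there is a constant $C_0>0$, depending only on $p$, such that for every $n\ge 2$, with probability at least $1-n^{-3}$, every unit eigenvector $x$ of $M$ for $\lambda_2(M)$ and every unit eigenvector $\widehat x$ of $\widehat M$ for $\lambda_2(\widehat M)$ satisfy, up to the choice of sign of $\widehat x$, \[ \|x-\widehat x\|\le C_0\,n^{-1/2},\qquad\text{i.e.}\qquad \min\bigl(\|x-\widehat x\|,\|x+\widehat x\|\bigr)\le C_0\,n^{-1/2}. \] The same holds if, for both matrices, the eigenvalues are instead labelled by decreasing absolute value, $|\lambda_1|\ge|\lambda_2|\ge\dots\ge|\lambda_n|$ (with ties ordered in any way). -/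

import Mathlib

open MeasureTheory ProbabilityTheory

/-- The model matrix on `n` ordered vertices: the entry `(i, j)` is `p` when `i ≠ j` and
`|i - j| ≤ n / 2` (compared as real numbers), and `0` otherwise. It is the matrix of edge
probabilities of a loopless graph, so its diagonal vanishes. -/
noncomputable def modelMatrix (p : ℝ) (n : ℕ) : Matrix (Fin n) (Fin n) ℝ :=
  Matrix.of fun i j => if i ≠ j ∧ |((i : ℕ) : ℝ) - ((j : ℕ) : ℝ)| ≤ (n : ℝ) / 2 then p else 0

/-- `G` is a random linear graph with link probability `p` under the probability measure `P`:
the events "`i` and `j` are adjacent", over the pairs `i < j`, are measurable and mutually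
independent, and have the probabilities given by the model matrix. -/
structure IsRandomLinearGraph {Ω : Type*} [MeasurableSpace Ω] (P : Measure Ω) (p : ℝ) {n : ℕ}
    (G : Ω → SimpleGraph (Fin n)) : Prop where
  measurable_adj : ∀ i j : Fin n, i < j → MeasurableSet {ω | (G ω).Adj i j}
  prob_adj : ∀ i j : Fin n, i < j → P.real {ω | (G ω).Adj i j} = modelMatrix p n i j
  indep_adj : iIndepSet
    (fun e : {e : Fin n × Fin n // e.1 < e.2} => {ω | (G ω).Adj e.1.1 e.1.2}) P

open Classical in
/-- The real adjacency matrix of a graph on `n` ordered vertices. -/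
noncomputable def adjacencyMatrix {n : ℕ} (G : SimpleGraph (Fin n)) : Matrix (Fin n) (Fin n) ℝ :=
  G.adjMatrix ℝ

/-- `ev` lists the eigenvalues of `A` with multiplicity, in such an order that their `key` is
non-increasing (`key = id`: decreasing order; `key = abs`: decreasing absolute values). -/
def IsEigenvalueListing (key : ℝ → ℝ) {n : ℕ} (A : Matrix (Fin n) (Fin n) ℝ)
    (ev : Fin n → ℝ) : Prop :=
  Finset.univ.val.map ev = A.charpoly.roots ∧ Antitone fun i => key (ev i)

/-- `x` is a unit eigenvector of `A` for `λ₂(A)`, the second entry of a listing of the eigenvalues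
of `A` in the order determined by `key`. -/
def IsSecondUnitEigenvector (key : ℝ → ℝ) {n : ℕ} (A : Matrix (Fin n) (Fin n) ℝ)
    (x : EuclideanSpace ℝ (Fin n)) : Prop :=
  ‖x‖ = 1 ∧ ∃ ev : Fin n → ℝ, IsEigenvalueListing key A ev ∧
    ∃ h : 1 < n, Matrix.toEuclideanLin A x = ev ⟨1, h⟩ • x

/-!
Write `M` for the model matrix, `M'` for the adjacency matrix of the random graph. The theorem is a
Davis–Kahan estimate: `M' - M` has norm `O(√n)` with the required probability, whereas `λ₂(M)` is
separated from the rest of the spectrum of `M` by a gap of order `p n`.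

*Noise.* For fixed `y`, `z` in the unit ball, the bilinear form of `M' - M` at `y`, `z` is a sum of
independent centred variables, one for each pair `i < j`, and Hoeffding's inequality gives it a tail
`exp (-t²)`. The unit ball has a `1/2`-net of at most `5 ^ n` points (`exists_half_net_unitBall`),
and the norm is at most four times the maximum of the bilinear form on the net, so a union bound
over `25 ^ n` pairs yields `IsRandomLinearGraph.one_sub_le_measureReal_norm_le`.

*Spectral gap.* No eigenvector of `M` has to be computed. Summing over the band is summing over the
square minus two corner triangles, which gives the quadratic form of `M` at the vectors
`α + β (n - 1 - 2 i)` in closed form; it is diagonal in `(α, β)`, with Rayleigh quotients close to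
`3/4 · p n` and `5/16 · p n`. By Courant–Fischer one eigenvalue exceeds `0.7499 p n` and a second
one exceeds `0.31 p n`. The squares of all eigenvalues add up to the squared Frobenius norm, which
is at most `3/4 (p n)²`; hence the second is at most `0.44 p n`, and as
`0.75 - 0.7499² - 0.31² < 0.304²` all others have absolute value at most `0.304 p n`
(`exists_modelMatrix_eigenvalues`).

*Perturbation.* Weyl's inequality, in the form of a count of eigenvalues above a threshold, places
`λ₂` of every matrix near `M` in the window around `λ₂(M)`. No eigenvalue is negative enough to
interfere, so this holds for both orders of the eigenvalues. Expanding a unit eigenvector in the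
eigenbasis of `M` bounds its components away from the second basis vector `e`. This is applied to
`M'` and to `M` itself, so that `x` and `y` are both compared with `e`
(`IsSecondUnitEigenvector.min_norm_eigenvectorBasis_sub_le`).
-/

/-! ### Nets of the unit ball and operator norms -/

/-- The closed unit ball of a `d`-dimensional real normed space has a `1/2`-net of at most `5 ^ d`
points: a `1/2`-separated subset of maximal cardinality is one. -/
theorem exists_half_net_unitBall (E : Type*) [NormedAddCommGroup E] [NormedSpace ℝ E]
    [FiniteDimensional ℝ E] :
    ∃ s : Finset E, s.card ≤ 5 ^ Module.finrank ℝ E ∧ (∀ c ∈ s, ‖c‖ ≤ 1) ∧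
      ∀ x : E, ‖x‖ ≤ 1 → ∃ c ∈ s, ‖x - c‖ ≤ 1 / 2 := by
  classical
  let Sep : Finset E → Prop := fun s =>
    (∀ c ∈ s, ‖c‖ ≤ 1) ∧ ∀ c ∈ s, ∀ d ∈ s, c ≠ d → 1 / 2 ≤ ‖c - d‖
  have hcard : ∀ s, Sep s → s.card ≤ 5 ^ Module.finrank ℝ E := by
    intro s hs
    have hinj : Function.Injective fun c : E => (2 : ℝ) • c :=
      smul_right_injective E (two_ne_zero' ℝ)
    rw [← Finset.card_image_of_injective s hinj]
    apply Besicovitch.card_le_of_separated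
    · intro c hc
      obtain ⟨d, hd, rfl⟩ := Finset.mem_image.1 hc
      rw [norm_smul, Real.norm_ofNat]
      linarith [hs.1 d hd]
    · intro c hc d hd hcd
      obtain ⟨a, ha, rfl⟩ := Finset.mem_image.1 hc
      obtain ⟨b, hb, rfl⟩ := Finset.mem_image.1 hd
      have := hs.2 a ha b hb (fun h => hcd (by rw [h]))
      rw [← smul_sub, norm_smul, Real.norm_ofNat]
      linarith
  let K : Set ℕ := {k | ∃ s, Sep s ∧ s.card = k}
  have hK : BddAbove K := ⟨5 ^ Module.finrank ℝ E, by rintro k ⟨s, hs, rfl⟩; exact hcard s hs⟩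
  have hne : K.Nonempty := ⟨0, ∅, ⟨by simp, by simp⟩, rfl⟩
  obtain ⟨s, hs, hsK⟩ := Nat.sSup_mem hne hK
  refine ⟨s, hcard s hs, hs.1, fun x hx => ?_⟩
  by_contra! hfar
  have hxs : x ∉ s := fun h => by
    have := hfar x h
    norm_num at this
  have hins : Sep (insert x s) := by
    refine ⟨fun c hc => ?_, fun c hc d hd hcd => ?_⟩
    · rcases Finset.mem_insert.1 hc with rfl | hc
      exacts [hx, hs.1 c hc]
    · rcases Finset.mem_insert.1 hc with rfl | hc'
      · rcases Finset.mem_insert.1 hd with rfl | hd'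
        · exact absurd rfl hcd
        · exact (hfar d hd').le
      · rcases Finset.mem_insert.1 hd with rfl | hd'
        · rw [norm_sub_rev]
          exact (hfar c hc').le
        · exact hs.2 c hc' d hd' hcd
  have := le_csSup hK ⟨_, hins, rfl⟩
  rw [Finset.card_insert_of_notMem hxs, ← hsK] at this
  omega

/-- The norm of an operator is controlled by its bilinear form on a `1/2`-net of the unit ball. -/
theorem norm_apply_le_of_half_net {E : Type*} [NormedAddCommGroup E] [InnerProductSpace ℝ E]
    [FiniteDimensional ℝ E] {s : Finset E}
    (hnet : ∀ x : E, ‖x‖ ≤ 1 → ∃ c ∈ s, ‖x - c‖ ≤ 1 / 2) {T : E →ₗ[ℝ] E} {κ : ℝ}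
    (hT : ∀ y ∈ s, ∀ z ∈ s, inner ℝ z (T y) ≤ κ) (v : E) : ‖T v‖ ≤ 4 * κ * ‖v‖ := by
  have hdual : ∀ w : E, (∀ z ∈ s, inner ℝ z w ≤ κ) → ‖w‖ ≤ 2 * κ := by
    intro w hw
    obtain ⟨z, hz, hzu⟩ := hnet ((‖w‖)⁻¹ • w) (by
      rw [norm_smul, norm_inv, norm_norm]
      exact inv_mul_le_one)
    have h1 : inner ℝ ((‖w‖)⁻¹ • w) w = ‖w‖ := by
      rw [real_inner_smul_left, real_inner_self_eq_norm_sq]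
      rcases eq_or_ne ‖w‖ 0 with h | h
      · simp [h]
      · field_simp
    have h2 : inner ℝ ((‖w‖)⁻¹ • w - z) w ≤ 1 / 2 * ‖w‖ :=
      (real_inner_le_norm _ _).trans (by gcongr)
    rw [inner_sub_left, h1] at h2
    linarith [hw z hz]
  let L := LinearMap.toContinuousLinearMap T
  have hκ : 0 ≤ κ := by
    obtain ⟨c, hc, -⟩ := hnet 0 (by simp)
    have := (norm_nonneg _).trans (hdual (T c) (hT c hc))
    linarith
  have hball : ∀ x : E, ‖x‖ = 1 → ‖L x‖ ≤ 2 * κ + ‖L‖ / 2 := by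
    intro x hx
    obtain ⟨c, hc, hxc⟩ := hnet x hx.le
    have h1 : ‖L c‖ ≤ 2 * κ := hdual _ (hT c hc)
    have h2 : ‖L (x - c)‖ ≤ ‖L‖ * (1 / 2) := (L.le_opNorm _).trans (by gcongr)
    have h3 : L x = L c + L (x - c) := by rw [map_sub]; abel
    rw [h3]
    linarith [norm_add_le (L c) (L (x - c))]
  have hL : ‖L‖ ≤ 2 * κ + ‖L‖ / 2 :=
    ContinuousLinearMap.opNorm_le_of_unit_norm (by positivity) hball
  have : ‖L‖ ≤ 4 * κ := by linarith
  exact (L.le_opNorm v).trans (by gcongr)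

/-! ### Concentration of the adjacency matrix -/

/-- The quadratic mass of the coefficients with which the independent entries above the diagonal
enter the bilinear form of a symmetric matrix at two vectors of the unit ball. -/
theorem sum_sq_symm_coeff_le {n : ℕ} {y z : EuclideanSpace ℝ (Fin n)} (hy : ‖y‖ ≤ 1)
    (hz : ‖z‖ ≤ 1) :
    ∑ e : {e : Fin n × Fin n // e.1 < e.2}, (z e.1.1 * y e.1.2 + z e.1.2 * y e.1.1) ^ 2 ≤ 2 := by
  have key : ∑ e : Fin n × Fin n, (z e.1 * y e.2) ^ 2 ≤ 1 := by
    rw [Fintype.sum_prod_type]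
    have h1 : ∑ i, (z i) ^ 2 ≤ 1 := by
      rw [← EuclideanSpace.real_norm_sq_eq]
      exact pow_le_one₀ (norm_nonneg _) hz
    have h2 : ∑ i, (y i) ^ 2 ≤ 1 := by
      rw [← EuclideanSpace.real_norm_sq_eq]
      exact pow_le_one₀ (norm_nonneg _) hy
    simp_rw [mul_pow, ← Finset.mul_sum, ← Finset.sum_mul]
    exact mul_le_one₀ h1 (Finset.sum_nonneg fun i _ => sq_nonneg _) h2
  have hsub : ∑ e : {e : Fin n × Fin n // e.1 < e.2}, (z e.1.1 * y e.1.2) ^ 2 +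
      ∑ e : {e : Fin n × Fin n // e.1 < e.2}, (z e.1.2 * y e.1.1) ^ 2 ≤
        ∑ e : Fin n × Fin n, (z e.1 * y e.2) ^ 2 := by
    classical
    rw [← Finset.sum_subtype (Finset.univ.filter fun e : Fin n × Fin n => e.1 < e.2)
        (by simp) (fun e => (z e.1 * y e.2) ^ 2),
      ← Finset.sum_subtype (Finset.univ.filter fun e : Fin n × Fin n => e.1 < e.2)
        (by simp) (fun e => (z e.2 * y e.1) ^ 2)]
    have hswap : ∑ e ∈ Finset.univ.filter (fun e : Fin n × Fin n => e.1 < e.2),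
        (z e.2 * y e.1) ^ 2 =
        ∑ e ∈ Finset.univ.filter (fun e : Fin n × Fin n => e.2 < e.1), (z e.1 * y e.2) ^ 2 :=
      Finset.sum_nbij' Prod.swap Prod.swap (by simp) (by simp) (by simp) (by simp) (by simp)
    rw [hswap, ← Finset.sum_union]
    · exact Finset.sum_le_sum_of_subset_of_nonneg (Finset.subset_univ _)
        fun _ _ _ => sq_nonneg _
    · rw [Finset.disjoint_filter]
      exact fun _ _ h => not_lt_of_gt h
  calc _ ≤ ∑ e : {e : Fin n × Fin n // e.1 < e.2},
        (2 * (z e.1.1 * y e.1.2) ^ 2 + 2 * (z e.1.2 * y e.1.1) ^ 2) :=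
        Finset.sum_le_sum fun e _ => by
          nlinarith [sq_nonneg (z e.1.1 * y e.1.2 - z e.1.2 * y e.1.1)]
    _ ≤ 2 := by
        rw [Finset.sum_add_distrib, ← Finset.mul_sum, ← Finset.mul_sum]
        linarith

/-- The bilinear form of a symmetric matrix with zero diagonal, in terms of the entries above the
diagonal. -/
theorem inner_toEuclideanLin_eq_sum_lt {n : ℕ} {B : Matrix (Fin n) (Fin n) ℝ}
    (hsymm : ∀ i j, B i j = B j i) (hdiag : ∀ i, B i i = 0) (y z : EuclideanSpace ℝ (Fin n)) :
    inner ℝ z (Matrix.toEuclideanLin B y) =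
      ∑ e : {e : Fin n × Fin n // e.1 < e.2},
        (z e.1.1 * y e.1.2 + z e.1.2 * y e.1.1) * B e.1.1 e.1.2 := by
  classical
  have h1 : inner ℝ z (Matrix.toEuclideanLin B y) =
      ∑ e : Fin n × Fin n, z e.1 * y e.2 * B e.1 e.2 := by
    rw [Fintype.sum_prod_type, PiLp.inner_apply]
    refine Finset.sum_congr rfl fun i _ => ?_
    simp only [Matrix.toEuclideanLin, Matrix.toLpLin_apply, Matrix.mulVec, dotProduct,
      RCLike.inner_apply, conj_trivial, Finset.sum_mul]
    exact Finset.sum_congr rfl fun j _ => by ring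
  rw [h1, ← Finset.sum_subtype (Finset.univ.filter fun e : Fin n × Fin n => e.1 < e.2)
        (by simp) (fun e => (z e.1 * y e.2 + z e.2 * y e.1) * B e.1 e.2)]
  simp_rw [add_mul]
  rw [Finset.sum_add_distrib]
  have hswap : ∑ e ∈ Finset.univ.filter (fun e : Fin n × Fin n => e.1 < e.2),
        z e.2 * y e.1 * B e.1 e.2 =
        ∑ e ∈ Finset.univ.filter (fun e : Fin n × Fin n => e.2 < e.1),
          z e.1 * y e.2 * B e.1 e.2 :=
    Finset.sum_nbij' Prod.swap Prod.swap (by simp) (by simp) (by simp) (by simp)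
      (fun e _ => by simp [hsymm e.1 e.2])
  rw [hswap, ← Finset.sum_union]
  · symm
    apply Finset.sum_subset (Finset.subset_univ _)
    rintro ⟨i, j⟩ - hij
    have : i = j := by
      simp only [Finset.mem_union, Finset.mem_filter, Finset.mem_univ, true_and] at hij
      omega
    subst this
    simp [hdiag]
  · rw [Finset.disjoint_filter]
    exact fun _ _ h => not_lt_of_gt h

theorem modelMatrix_symm (p : ℝ) (n : ℕ) (i j : Fin n) :
    modelMatrix p n i j = modelMatrix p n j i := by
  simp only [modelMatrix, Matrix.of_apply, ne_comm (a := i), abs_sub_comm ((i : ℕ) : ℝ)]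

theorem modelMatrix_isHermitian (p : ℝ) (n : ℕ) : (modelMatrix p n).IsHermitian :=
  Matrix.IsHermitian.ext fun i j => modelMatrix_symm p n j i

theorem adjacencyMatrix_isHermitian {n : ℕ} (G : SimpleGraph (Fin n)) :
    (adjacencyMatrix G).IsHermitian := by
  classical
  exact Matrix.IsHermitian.ext fun i j => by simp [adjacencyMatrix, SimpleGraph.adj_comm]

section Concentration

variable {Ω : Type*} [MeasurableSpace Ω] {P : Measure Ω} [IsProbabilityMeasure P] {p : ℝ} {n : ℕ}
  {G : Ω → SimpleGraph (Fin n)}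

/-- Hoeffding's inequality for the bilinear form of the centred adjacency matrix. -/
theorem IsRandomLinearGraph.measureReal_le_inner_le (hG : IsRandomLinearGraph P p G)
    {y z : EuclideanSpace ℝ (Fin n)} (hy : ‖y‖ ≤ 1) (hz : ‖z‖ ≤ 1) {t : ℝ} (ht : 0 ≤ t) :
    P.real {ω | t ≤ inner ℝ z
      (Matrix.toEuclideanLin (adjacencyMatrix (G ω) - modelMatrix p n) y)} ≤
        Real.exp (-t ^ 2) := by
  classical
  let A : {e : Fin n × Fin n // e.1 < e.2} → Set Ω := fun e => {ω | (G ω).Adj e.1.1 e.1.2}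
  let c : {e : Fin n × Fin n // e.1 < e.2} → ℝ :=
    fun e => z e.1.1 * y e.1.2 + z e.1.2 * y e.1.1
  let X : {e : Fin n × Fin n // e.1 < e.2} → Ω → ℝ :=
    fun e ω => c e * ((A e).indicator (fun _ => (1 : ℝ)) ω - modelMatrix p n e.1.1 e.1.2)
  have hA : ∀ e, MeasurableSet (A e) := fun e => hG.measurable_adj _ _ e.2
  have hmean : ∀ e, P[(A e).indicator fun _ => (1 : ℝ)] = modelMatrix p n e.1.1 e.1.2 := by
    intro e
    rw [← hG.prob_adj _ _ e.2]
    exact integral_indicator_one (hA e)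
  have hsub : ∀ e, HasSubgaussianMGF (X e) (Real.toNNReal (c e ^ 2 / 4)) P := by
    intro e
    have h := hasSubgaussianMGF_of_mem_Icc (μ := P) (a := 0) (b := 1)
      (X := (A e).indicator fun _ => (1 : ℝ))
      ((measurable_const.indicator (hA e)).aemeasurable)
      (Filter.Eventually.of_forall fun ω => by
        by_cases hω : ω ∈ A e <;> simp [hω])
    rw [hmean] at h
    convert h.const_mul (c e) using 1
    ext
    rw [Real.coe_toNNReal _ (by positivity)]
    change c e ^ 2 / 4 = c e ^ 2 * (‖(1 : ℝ) - 0‖ / 2) ^ 2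
    norm_num
    ring
  have hind : iIndepFun X P :=
    (hG.indep_adj.iIndepFun_indicator (β := ℝ)).comp
      (fun e x => c e * (x - modelMatrix p n e.1.1 e.1.2)) (fun e => by fun_prop)
  have hsum := HasSubgaussianMGF.sum_of_iIndepFun hind (s := Finset.univ) fun e _ => hsub e
  -- Enlarging the variance proxy to `1 / 2` avoids a division by zero when all `c e` vanish.
  have hsum' : HasSubgaussianMGF (fun ω => ∑ e, X e ω) (1 / 2) P := by
    refine ⟨hsum.integrable_exp_mul, fun s => (hsum.mgf_le s).trans ?_⟩
    apply Real.exp_le_exp.2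
    have : ((∑ e, Real.toNNReal (c e ^ 2 / 4) : NNReal) : ℝ) ≤ 1 / 2 := by
      have h : ∑ e, c e ^ 2 ≤ 2 := sum_sq_symm_coeff_le hy hz
      rw [NNReal.coe_sum, Finset.sum_congr rfl fun e _ =>
        Real.coe_toNNReal (c e ^ 2 / 4) (by positivity), ← Finset.sum_div]
      linarith
    have h2 : ((1 / 2 : NNReal) : ℝ) = 1 / 2 := by norm_num
    rw [h2]
    gcongr
  have hrw : ∀ ω, inner ℝ z
      (Matrix.toEuclideanLin (adjacencyMatrix (G ω) - modelMatrix p n) y) = ∑ e, X e ω := by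
    intro ω
    rw [inner_toEuclideanLin_eq_sum_lt]
    · refine Finset.sum_congr rfl fun e _ => ?_
      simp only [X, c, A, adjacencyMatrix, Matrix.sub_apply, SimpleGraph.adjMatrix_apply,
        Set.indicator_apply, Set.mem_ofPred_eq]
    · intro i j
      simp [adjacencyMatrix, modelMatrix_symm p n i j, SimpleGraph.adj_comm]
    · intro i
      simp [adjacencyMatrix, modelMatrix]
  simp_rw [hrw]
  refine (hsum'.measure_ge_le ht).trans (le_of_eq ?_)
  congr 1
  norm_num

/-- With probability at least `1 - n⁻³` the centred adjacency matrix has norm at most `12 √n`: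
a union bound over pairs of points of a `1/2`-net. -/
theorem IsRandomLinearGraph.one_sub_le_measureReal_norm_le (hG : IsRandomLinearGraph P p G)
    (hn : 1 ≤ n) :
    1 - (n : ℝ) ^ (-3 : ℤ) ≤ P.real {ω | ∀ v, ‖Matrix.toEuclideanLin
      (adjacencyMatrix (G ω) - modelMatrix p n) v‖ ≤ 12 * √n * ‖v‖} := by
  classical
  obtain ⟨s, hcard, hball, hnet⟩ := exists_half_net_unitBall (EuclideanSpace ℝ (Fin n))
  rw [finrank_euclideanSpace_fin] at hcard
  let bad : EuclideanSpace ℝ (Fin n) × EuclideanSpace ℝ (Fin n) → Set Ω := fun q =>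
    {ω | 3 * √n ≤ inner ℝ q.2
      (Matrix.toEuclideanLin (adjacencyMatrix (G ω) - modelMatrix p n) q.1)}
  set good : Set Ω := {ω | ∀ v, ‖Matrix.toEuclideanLin
      (adjacencyMatrix (G ω) - modelMatrix p n) v‖ ≤ 12 * √n * ‖v‖} with hgood
  have hcover : (Set.univ : Set Ω) ⊆ good ∪ ⋃ q ∈ s ×ˢ s, bad q := by
    intro ω _
    by_cases hω : ω ∈ ⋃ q ∈ s ×ˢ s, bad q
    · exact Or.inr hω
    · left
      simp only [Set.mem_iUnion, not_exists] at hω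
      intro v
      have := norm_apply_le_of_half_net hnet (κ := 3 * √n)
        (T := Matrix.toEuclideanLin (adjacencyMatrix (G ω) - modelMatrix p n))
        (fun y hy z hz => (lt_of_not_ge (hω (y, z) (Finset.mk_mem_product hy hz))).le) v
      linarith
  have hbad : P.real (⋃ q ∈ s ×ˢ s, bad q) ≤ (n : ℝ) ^ (-3 : ℤ) := by
    have hn0 : (0 : ℝ) < n := by exact_mod_cast hn
    -- Each of the at most `25 ^ n ≤ exp (4 n)` events has probability at most `exp (-9 n)`.
    have h25 : (25 : ℝ) ≤ Real.exp 4 := by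
      have h1 : (2.7 : ℝ) ≤ Real.exp 1 := by linarith [Real.exp_one_gt_d9]
      have h2 : Real.exp 4 = Real.exp 1 ^ 4 := by rw [← Real.exp_nat_mul]; norm_num
      rw [h2]
      calc (25 : ℝ) ≤ 2.7 ^ 4 := by norm_num
        _ ≤ _ := by gcongr
    calc P.real (⋃ q ∈ s ×ˢ s, bad q) ≤ ∑ q ∈ s ×ˢ s, P.real (bad q) :=
          measureReal_biUnion_finset_le _ _
      _ ≤ ∑ q ∈ s ×ˢ s, Real.exp (-(9 * n)) := by
          refine Finset.sum_le_sum fun q hq => ?_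
          rw [Finset.mem_product] at hq
          refine (hG.measureReal_le_inner_le (hball _ hq.1) (hball _ hq.2)
            (by positivity)).trans (le_of_eq ?_)
          rw [mul_pow, Real.sq_sqrt hn0.le]
          norm_num
      _ = (s.card : ℝ) * s.card * Real.exp (-(9 * n)) := by
          rw [Finset.sum_const, Finset.card_product, nsmul_eq_mul]
          push_cast
          ring
      _ ≤ 5 ^ n * 5 ^ n * Real.exp (-(9 * n)) := by
          have : (s.card : ℝ) ≤ 5 ^ n := by exact_mod_cast hcard
          gcongr
      _ = 25 ^ n * Real.exp (-(9 * n)) := by rw [← mul_pow]; norm_num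
      _ ≤ Real.exp 4 ^ n * Real.exp (-(9 * n)) := by gcongr
      _ = Real.exp (-(5 * n)) := by
          rw [← Real.exp_nat_mul, ← Real.exp_add]
          congr 1
          ring
      _ ≤ (n : ℝ) ^ (-3 : ℤ) := by
          rw [zpow_neg, Real.exp_neg]
          apply inv_anti₀ (by positivity)
          calc (n : ℝ) ^ (3 : ℤ) = (n : ℝ) ^ 3 := by norm_cast
            _ ≤ Real.exp n ^ 3 := by
                gcongr
                linarith [Real.add_one_le_exp (n : ℝ)]
            _ = Real.exp (3 * n) := by rw [← Real.exp_nat_mul]; norm_num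
            _ ≤ Real.exp (5 * n) := by
                apply Real.exp_le_exp.2
                linarith
  have h1 : (1 : ℝ) ≤ P.real good + P.real (⋃ q ∈ s ×ˢ s, bad q) := by
    calc (1 : ℝ) = P.real Set.univ := by simp
      _ ≤ P.real (good ∪ ⋃ q ∈ s ×ˢ s, bad q) := measureReal_mono hcover
      _ ≤ _ := measureReal_union_le _ _
  linarith

end Concentration

/-! ### Eigenvalue counting and perturbation of eigenvectors -/

section Spectral

variable {n : ℕ} {A B : Matrix (Fin n) (Fin n) ℝ}

theorem toEuclideanLin_eigenvectorBasis (hA : A.IsHermitian) (i : Fin n) :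
    Matrix.toEuclideanLin A (hA.eigenvectorBasis i) =
      hA.eigenvalues i • hA.eigenvectorBasis i := by
  ext j
  simpa [Matrix.toEuclideanLin, Matrix.toLpLin_apply] using
    congrFun (hA.mulVec_eigenvectorBasis i) j

theorem inner_toEuclideanLin_comm (hA : A.IsHermitian) (v w : EuclideanSpace ℝ (Fin n)) :
    inner ℝ (Matrix.toEuclideanLin A v) w = inner ℝ v (Matrix.toEuclideanLin A w) :=
  Matrix.isSymmetric_toEuclideanLin_iff.2 hA v w

theorem inner_eigenvectorBasis_toEuclideanLin (hA : A.IsHermitian) (i : Fin n)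
    (v : EuclideanSpace ℝ (Fin n)) :
    inner ℝ (hA.eigenvectorBasis i) (Matrix.toEuclideanLin A v) =
      hA.eigenvalues i * inner ℝ (hA.eigenvectorBasis i) v := by
  rw [← inner_toEuclideanLin_comm hA, toEuclideanLin_eigenvectorBasis, real_inner_smul_left]

theorem inner_toEuclideanLin_self_eq_sum (hA : A.IsHermitian) (v : EuclideanSpace ℝ (Fin n)) :
    inner ℝ v (Matrix.toEuclideanLin A v) =
      ∑ i, hA.eigenvalues i * inner ℝ (hA.eigenvectorBasis i) v ^ 2 := by
  rw [← hA.eigenvectorBasis.sum_inner_mul_inner]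
  refine Finset.sum_congr rfl fun i _ => ?_
  rw [inner_eigenvectorBasis_toEuclideanLin, real_inner_comm v]
  ring

theorem norm_sq_eq_sum_inner_sq (b : OrthonormalBasis (Fin n) ℝ (EuclideanSpace ℝ (Fin n)))
    (v : EuclideanSpace ℝ (Fin n)) : ‖v‖ ^ 2 = ∑ i, inner ℝ (b i) v ^ 2 := by
  rw [← b.sum_sq_norm_inner_right v]
  simp

/-- The half of the Courant–Fischer principle that bounds eigenvalues from below: a space of test
vectors with Rayleigh quotients above `t` forces as many eigenvalues above `t` as its dimension. -/
theorem finrank_le_card_eigenvalues_gt (hA : A.IsHermitian) {F : Type*} [AddCommGroup F]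
    [Module ℝ F] [FiniteDimensional ℝ F] (φ : F →ₗ[ℝ] EuclideanSpace ℝ (Fin n)) {t : ℝ}
    (hφ : ∀ c, c ≠ 0 → t * ‖φ c‖ ^ 2 < inner ℝ (φ c) (Matrix.toEuclideanLin A (φ c))) :
    Module.finrank ℝ F ≤ (Finset.univ.filter fun i => t < hA.eigenvalues i).card := by
  classical
  set S := Finset.univ.filter fun i => t < hA.eigenvalues i with hS
  let ψ : F →ₗ[ℝ] (S → ℝ) :=
    LinearMap.pi fun i => (innerₛₗ ℝ (hA.eigenvectorBasis i)).comp φ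
  have hψ : Function.Injective ψ := by
    rw [← LinearMap.ker_eq_bot, LinearMap.ker_eq_bot']
    intro c hc
    by_contra hc0
    have h1 := hφ c hc0
    rw [inner_toEuclideanLin_self_eq_sum hA, norm_sq_eq_sum_inner_sq hA.eigenvectorBasis,
      Finset.mul_sum] at h1
    refine absurd h1 (not_lt.2 (Finset.sum_le_sum fun i _ => ?_))
    by_cases hi : i ∈ S
    · have : inner ℝ (hA.eigenvectorBasis i) (φ c) = 0 := congrFun hc ⟨i, hi⟩
      simp [this]
    · have : hA.eigenvalues i ≤ t := by simpa [hS] using hi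
      gcongr
  simpa using LinearMap.finrank_le_finrank_of_injective hψ

/-- Weyl's inequality in counting form: a perturbation of norm at most `η` moves eigenvalues down
by at most `η`. -/
theorem card_eigenvalues_gt_le_of_norm_le (hA : A.IsHermitian) (hB : B.IsHermitian) {η : ℝ}
    (hAB : ∀ v, ‖Matrix.toEuclideanLin (B - A) v‖ ≤ η * ‖v‖) (t : ℝ) :
    (Finset.univ.filter fun i => t < hA.eigenvalues i).card ≤
      (Finset.univ.filter fun i => t - η < hB.eigenvalues i).card := by
  classical
  set S := Finset.univ.filter fun i => t < hA.eigenvalues i with hS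
  have hon : Orthonormal ℝ fun i : S => hA.eigenvectorBasis i :=
    hA.eigenvectorBasis.orthonormal.comp _ Subtype.val_injective
  let φ : (S → ℝ) →ₗ[ℝ] EuclideanSpace ℝ (Fin n) :=
    Fintype.linearCombination ℝ fun i : S => hA.eigenvectorBasis i
  have hφ : ∀ c, φ c = ∑ i : S, c i • hA.eigenvectorBasis i := fun c => rfl
  have h := finrank_le_card_eigenvalues_gt hB φ (t := t - η) (fun c hc => ?_)
  · simpa using h
  have hnorm : ‖φ c‖ ^ 2 = ∑ i, c i ^ 2 := by
    rw [← real_inner_self_eq_norm_sq, hφ, hon.inner_sum]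
    simp [sq]
  have hA' : inner ℝ (φ c) (Matrix.toEuclideanLin A (φ c)) =
      ∑ i : S, hA.eigenvalues i * c i ^ 2 := by
    have : Matrix.toEuclideanLin A (φ c) =
        ∑ i : S, (hA.eigenvalues i * c i) • hA.eigenvectorBasis i := by
      rw [hφ, map_sum]
      refine Finset.sum_congr rfl fun i _ => ?_
      rw [map_smul, toEuclideanLin_eigenvectorBasis, smul_smul, mul_comm]
    rw [this, hφ, hon.inner_sum]
    refine Finset.sum_congr rfl fun i _ => ?_
    simp only [conj_trivial]
    ring
  have hlt : t * ‖φ c‖ ^ 2 < inner ℝ (φ c) (Matrix.toEuclideanLin A (φ c)) := by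
    rw [hnorm, hA', Finset.mul_sum]
    obtain ⟨i, hi⟩ := Function.ne_iff.1 hc
    have ht : ∀ i : S, t < hA.eigenvalues i := fun i => (Finset.mem_filter.1 i.2).2
    refine Finset.sum_lt_sum (fun j _ => ?_) ⟨i, Finset.mem_univ _, ?_⟩
    · have := ht j
      gcongr
    · exact mul_lt_mul_of_pos_right (ht i) (sq_pos_of_ne_zero hi)
  have hdiff : -(η * ‖φ c‖ ^ 2) ≤ inner ℝ (φ c) (Matrix.toEuclideanLin (B - A) (φ c)) := by
    have h1 := (abs_le.1 (abs_real_inner_le_norm (φ c)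
      (Matrix.toEuclideanLin (B - A) (φ c)))).1
    have h2 := mul_le_mul_of_nonneg_left (hAB (φ c)) (norm_nonneg (φ c))
    nlinarith
  rw [map_sub, LinearMap.sub_apply, inner_sub_right] at hdiff
  linarith

/-- The eigenvalues of a symmetric matrix carry its squared Frobenius norm. -/
theorem sum_eigenvalues_sq (hA : A.IsHermitian) :
    ∑ i, hA.eigenvalues i ^ 2 = ∑ i, ∑ j, A i j ^ 2 := by
  have h1 : ∀ i, hA.eigenvalues i ^ 2 =
      ∑ k, inner ℝ (EuclideanSpace.basisFun (Fin n) ℝ k)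
        (Matrix.toEuclideanLin A (hA.eigenvectorBasis i)) ^ 2 := by
    intro i
    rw [← norm_sq_eq_sum_inner_sq, toEuclideanLin_eigenvectorBasis, norm_smul,
      hA.eigenvectorBasis.orthonormal.1 i, mul_one, Real.norm_eq_abs, sq_abs]
  simp_rw [h1]
  rw [Finset.sum_comm]
  refine Finset.sum_congr rfl fun k _ => ?_
  have h2 : ∀ i, inner ℝ (EuclideanSpace.basisFun (Fin n) ℝ k)
      (Matrix.toEuclideanLin A (hA.eigenvectorBasis i)) =
      inner ℝ (hA.eigenvectorBasis i)
        (Matrix.toEuclideanLin A (EuclideanSpace.basisFun (Fin n) ℝ k)) := by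
    intro i
    rw [← inner_toEuclideanLin_comm hA, real_inner_comm]
  simp_rw [h2]
  rw [← norm_sq_eq_sum_inner_sq, EuclideanSpace.real_norm_sq_eq]
  refine Finset.sum_congr rfl fun j _ => ?_
  have : Matrix.toEuclideanLin A (EuclideanSpace.basisFun (Fin n) ℝ k) j = A j k := by
    simp [Matrix.toEuclideanLin, Matrix.toLpLin_apply]
  rw [this]
  congr 1
  simpa using hA.apply k j

theorem IsEigenvalueListing.card_filter_eq {key : ℝ → ℝ} {ev : Fin n → ℝ}
    (hev : IsEigenvalueListing key A ev) (hA : A.IsHermitian) (q : ℝ → Prop) [DecidablePred q] :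
    (Finset.univ.filter fun i => q (ev i)).card =
      (Finset.univ.filter fun i => q (hA.eigenvalues i)).card := by
  have h : Finset.univ.val.map ev = Finset.univ.val.map hA.eigenvalues := by
    rw [hev.1, hA.roots_charpoly_eq_eigenvalues]
    rfl
  have := congrArg (Multiset.countP q) h
  rw [Multiset.countP_map, Multiset.countP_map] at this
  exact this

/-- For both orders the second listed eigenvalue is the second largest one, as soon as no
eigenvalue is below `-τ` while two of them exceed `τ`. -/
theorem IsEigenvalueListing.second_mem_Ioc {key : ℝ → ℝ} (hkey : key = id ∨ key = fun t => |t|)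
    {ev : Fin n → ℝ} (hev : IsEigenvalueListing key A ev) (hA : A.IsHermitian) (hn : 1 < n)
    {τ σ : ℝ} (hτσ : τ ≤ σ) (hlow : ∀ i, -τ < hA.eigenvalues i)
    (htwo : 2 ≤ (Finset.univ.filter fun i => τ < hA.eigenvalues i).card)
    (hone : (Finset.univ.filter fun i => σ < hA.eigenvalues i).card ≤ 1) :
    ev ⟨1, hn⟩ ∈ Set.Ioc τ σ := by
  have hlow' : ∀ i, -τ < ev i := by
    have h0 : (Finset.univ.filter fun i => ev i ≤ -τ).card = 0 := by
      rw [hev.card_filter_eq hA fun x => x ≤ -τ, Finset.card_eq_zero, Finset.filter_eq_empty_iff]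
      exact fun i _ => not_le.2 (hlow i)
    rw [Finset.card_eq_zero, Finset.filter_eq_empty_iff] at h0
    exact fun i => not_le.1 (h0 (Finset.mem_univ i))
  rw [← hev.card_filter_eq hA fun x => τ < x] at htwo
  rw [← hev.card_filter_eq hA fun x => σ < x] at hone
  have hmono : ∀ {i j : Fin n}, i ≤ j → ∀ s, τ ≤ s → s < ev j → s < ev i := by
    intro i j hij s hs hj
    have h := hev.2 hij
    rcases hkey with rfl | rfl
    · exact hj.trans_le h
    · have h1 : s < |ev i| := (hj.trans_le (le_abs_self _)).trans_le h
      rcases lt_abs.1 h1 with h2 | h2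
      · exact h2
      · linarith [hlow' i]
  constructor
  · by_contra! hle
    have hsub : (Finset.univ.filter fun i => τ < ev i) ⊆ {⟨0, by omega⟩} := by
      intro i hi
      rw [Finset.mem_singleton]
      by_contra hi0
      have h1 : (⟨1, hn⟩ : Fin n) ≤ i := by
        have : (i : ℕ) ≠ 0 := fun h => hi0 (Fin.ext h)
        exact Fin.le_def.2 (by simp only; omega)
      exact absurd (hmono h1 τ le_rfl (Finset.mem_filter.1 hi).2) (not_lt.2 hle)
    have := Finset.card_le_card hsub
    rw [Finset.card_singleton] at this
    omega
  · by_contra! hlt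
    have h0 : σ < ev ⟨0, by omega⟩ := hmono (Fin.le_def.2 (by simp)) σ hτσ hlt
    have := Finset.card_le_one.1 hone ⟨0, by omega⟩ (by simpa using h0) ⟨1, hn⟩ (by simpa using hlt)
    simp at this

theorem min_norm_sub_norm_add_le {E : Type*} [NormedAddCommGroup E] [InnerProductSpace ℝ E]
    {e y : E} (he : ‖e‖ = 1) (hy : ‖y‖ = 1) {ε : ℝ} (hε : 0 ≤ ε)
    (h : 1 - inner ℝ e y ^ 2 ≤ ε ^ 2) : min ‖e - y‖ ‖e + y‖ ≤ 2 * ε := by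
  have h1 := norm_sub_sq_real e y
  have h2 := norm_add_sq_real e y
  rw [he, hy] at h1 h2
  have hb := abs_le.1 ((abs_real_inner_le_norm e y).trans (by rw [he, hy, one_mul]))
  rcases le_total 0 (inner ℝ e y) with h0 | h0
  · refine (min_le_left _ _).trans (abs_le_of_sq_le_sq' ?_ (by positivity)).2
    nlinarith [sq_nonneg ε]
  · refine (min_le_right _ _).trans (abs_le_of_sq_le_sq' ?_ (by positivity)).2
    nlinarith [sq_nonneg ε]

/-- A Davis–Kahan bound: an approximate eigenvector `y` with approximate eigenvalue `μ` is close
to the eigenvector `i` when all other eigenvalues are at distance at least `δ` from `μ`. -/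
theorem min_norm_eigenvectorBasis_sub_le_of_residual (hA : A.IsHermitian) {i₁ : Fin n} {μ δ η : ℝ}
    (hδ : 0 < δ) (hη : 0 ≤ η) (hgap : ∀ i, i ≠ i₁ → δ ≤ |hA.eigenvalues i - μ|)
    {y : EuclideanSpace ℝ (Fin n)} (hy : ‖y‖ = 1)
    (hres : ‖Matrix.toEuclideanLin A y - μ • y‖ ≤ η) :
    min ‖hA.eigenvectorBasis i₁ - y‖ ‖hA.eigenvectorBasis i₁ + y‖ ≤ 2 * (η / δ) := by
  classical
  apply min_norm_sub_norm_add_le (hA.eigenvectorBasis.orthonormal.1 i₁) hy (by positivity)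
  have h1 : 1 = ∑ i, inner ℝ (hA.eigenvectorBasis i) y ^ 2 := by
    rw [← norm_sq_eq_sum_inner_sq, hy, one_pow]
  have h2 : ∑ i, ((hA.eigenvalues i - μ) * inner ℝ (hA.eigenvectorBasis i) y) ^ 2 ≤ η ^ 2 := by
    calc _ = ‖Matrix.toEuclideanLin A y - μ • y‖ ^ 2 := by
          rw [norm_sq_eq_sum_inner_sq hA.eigenvectorBasis]
          refine Finset.sum_congr rfl fun i _ => ?_
          rw [inner_sub_right, inner_eigenvectorBasis_toEuclideanLin, real_inner_smul_right]
          ring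
      _ ≤ η ^ 2 := by gcongr
  have hsplit1 := Finset.sum_erase_add Finset.univ
    (fun i => inner ℝ (hA.eigenvectorBasis i) y ^ 2) (Finset.mem_univ i₁)
  have h3 : δ ^ 2 * ∑ i ∈ Finset.univ.erase i₁, inner ℝ (hA.eigenvectorBasis i) y ^ 2 ≤ η ^ 2 := by
    refine le_trans ?_ h2
    rw [Finset.mul_sum]
    calc _ ≤ ∑ i ∈ Finset.univ.erase i₁,
          ((hA.eigenvalues i - μ) * inner ℝ (hA.eigenvectorBasis i) y) ^ 2 := by
          refine Finset.sum_le_sum fun i hi => ?_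
          rw [mul_pow]
          refine mul_le_mul_of_nonneg_right ?_ (sq_nonneg _)
          rw [← sq_abs (hA.eigenvalues i - μ)]
          have := hgap i (Finset.ne_of_mem_erase hi)
          gcongr
      _ ≤ _ := Finset.sum_le_sum_of_subset_of_nonneg (Finset.erase_subset _ _)
          fun _ _ _ => sq_nonneg _
  rw [div_pow, le_div_iff₀ (by positivity)]
  nlinarith

/-- If exactly two eigenvalues of `A` leave `[-τ, τ]`, both to the right, and they are well
separated from `[-τ, τ]` and from each other, then `λ₂` of every small perturbation `B` has its
unit eigenvectors close to `±` the eigenvector `i₁` of `A`. -/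
theorem IsSecondUnitEigenvector.min_norm_eigenvectorBasis_sub_le {key : ℝ → ℝ}
    (hkey : key = id ∨ key = fun t => |t|) (hA : A.IsHermitian) (hB : B.IsHermitian)
    {i₀ i₁ : Fin n} (hi : i₀ ≠ i₁) {τ τ' σ σ' δ η : ℝ} (hδ : 0 < δ) (hη : 0 ≤ η) (hηδ : η ≤ δ)
    (hτ : τ + 3 * δ ≤ τ') (hσ : σ + 2 * δ ≤ σ') (h₀ : σ' < hA.eigenvalues i₀)
    (h₁ : hA.eigenvalues i₁ ∈ Set.Ioc τ' σ)
    (hrest : ∀ i, i ≠ i₀ → i ≠ i₁ → |hA.eigenvalues i| ≤ τ) (hτ0 : 0 ≤ τ)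
    (hAB : ∀ v, ‖Matrix.toEuclideanLin (B - A) v‖ ≤ η * ‖v‖)
    {y : EuclideanSpace ℝ (Fin n)} (hy : IsSecondUnitEigenvector key B y) :
    min ‖hA.eigenvectorBasis i₁ - y‖ ‖hA.eigenvectorBasis i₁ + y‖ ≤ 2 * (η / δ) := by
  classical
  obtain ⟨hy1, ev, hev, hn, hye⟩ := hy
  have hτσ : τ' < σ := h₁.1.trans_le h₁.2
  have hcases : ∀ i, hA.eigenvalues i ≤ τ ∧ -τ ≤ hA.eigenvalues i ∨ i = i₀ ∨ i = i₁ := by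
    intro i
    by_cases hi0 : i = i₀
    · exact Or.inr (Or.inl hi0)
    by_cases hi1 : i = i₁
    · exact Or.inr (Or.inr hi1)
    exact Or.inl ⟨(abs_le.1 (hrest i hi0 hi1)).2, (abs_le.1 (hrest i hi0 hi1)).1⟩
  have hlowA : ∀ i, -τ ≤ hA.eigenvalues i := by
    intro i
    rcases hcases i with h | rfl | rfl
    · exact h.2
    · linarith
    · linarith [h₁.1]
  have hwin : ev ⟨1, hn⟩ ∈ Set.Ioc (τ' - δ) (σ + δ) := by
    apply hev.second_mem_Ioc hkey hB hn (by linarith)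
    · intro i
      set b := hB.eigenvectorBasis i with hb
      have hb1 : ‖b‖ = 1 := hB.eigenvectorBasis.orthonormal.1 i
      have e1 : inner ℝ b (Matrix.toEuclideanLin B b) = hB.eigenvalues i := by
        rw [hb, toEuclideanLin_eigenvectorBasis, real_inner_smul_right,
          real_inner_self_eq_norm_sq, ← hb, hb1]
        ring
      have e2 : -τ ≤ inner ℝ b (Matrix.toEuclideanLin A b) := by
        rw [inner_toEuclideanLin_self_eq_sum hA]
        calc -τ = ∑ i, -τ * inner ℝ (hA.eigenvectorBasis i) b ^ 2 := by
              rw [← Finset.mul_sum, ← norm_sq_eq_sum_inner_sq, hb1]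
              ring
          _ ≤ _ := Finset.sum_le_sum fun i _ => by
              have := hlowA i
              gcongr
      have e3 := (abs_le.1 (abs_real_inner_le_norm b (Matrix.toEuclideanLin (B - A) b))).1
      have e4 := hAB b
      rw [hb1] at e3 e4
      rw [map_sub, LinearMap.sub_apply, inner_sub_right, e1] at e3
      rw [map_sub, LinearMap.sub_apply] at e4
      linarith
    · calc 2 = ({i₀, i₁} : Finset (Fin n)).card := (Finset.card_pair hi).symm
        _ ≤ (Finset.univ.filter fun i => τ' < hA.eigenvalues i).card := by
            apply Finset.card_le_card
            intro i hi
            rw [Finset.mem_insert, Finset.mem_singleton] at hi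
            rw [Finset.mem_filter]
            refine ⟨Finset.mem_univ _, ?_⟩
            rcases hi with rfl | rfl
            · linarith
            · exact h₁.1
        _ ≤ _ := card_eigenvalues_gt_le_of_norm_le hA hB hAB τ'
        _ ≤ _ := by
            apply Finset.card_le_card
            intro i hi
            rw [Finset.mem_filter] at hi ⊢
            exact ⟨hi.1, by linarith [hi.2]⟩
    · have hBA : ∀ v, ‖Matrix.toEuclideanLin (A - B) v‖ ≤ η * ‖v‖ := by
        intro v
        rw [← neg_sub B A, map_neg, LinearMap.neg_apply, norm_neg]
        exact hAB v
      refine (card_eigenvalues_gt_le_of_norm_le hB hA hBA (σ + δ)).trans ?_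
      rw [← Finset.card_singleton i₀]
      apply Finset.card_le_card
      intro i hσi
      rw [Finset.mem_filter] at hσi
      rw [Finset.mem_singleton]
      rcases hcases i with h | h | rfl
      · linarith [h.1, hσi.2]
      · exact h
      · linarith [h₁.2, hσi.2]
  apply min_norm_eigenvectorBasis_sub_le_of_residual (μ := ev ⟨1, hn⟩) hA hδ hη _ hy1
  · have : Matrix.toEuclideanLin A y - ev ⟨1, hn⟩ • y = -Matrix.toEuclideanLin (B - A) y := by
      rw [map_sub, LinearMap.sub_apply, hye]
      abel
    rw [this, norm_neg]
    simpa [hy1] using hAB y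
  · intro i hi1
    rcases hcases i with h | rfl | h
    · rw [abs_sub_comm]
      exact le_trans (by linarith [hwin.1, h.1]) (le_abs_self _)
    · exact le_trans (by linarith [hwin.2]) (le_abs_self _)
    · exact absurd h hi1

end Spectral

/-! ### The spectrum of the model matrix -/

section Model

/-- A sum over the band `|i - j| ≤ ⌊n/2⌋` is the full sum minus the sums over two corner
triangles; the reflection `j = n - 1 - k` gives the corners the shape `i + k < r`. -/
theorem sum_band_eq (n : ℕ) (f : ℕ → ℝ) :
    ∑ i ∈ Finset.range n, ∑ j ∈ Finset.range n,
        (if i ≤ j + n / 2 ∧ j ≤ i + n / 2 then f i * f j else 0) =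
      (∑ i ∈ Finset.range n, f i) ^ 2 -
        2 * ∑ i ∈ Finset.range (n - 1 - n / 2),
          f i * ∑ k ∈ Finset.range (n - 1 - n / 2 - i), f (n - 1 - k) := by
  have hcorner : ∑ i ∈ Finset.range n, ∑ j ∈ Finset.range n,
      (if i + n / 2 < j then f i * f j else 0) =
      ∑ i ∈ Finset.range (n - 1 - n / 2),
          f i * ∑ k ∈ Finset.range (n - 1 - n / 2 - i), f (n - 1 - k) := by
    rw [← Finset.sum_subset (Finset.range_subset_range.2 (by omega : n - 1 - n / 2 ≤ n))]
    · refine Finset.sum_congr rfl fun i hi => ?_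
      rw [Finset.mem_range] at hi
      rw [← Finset.sum_range_reflect, Finset.mul_sum,
        ← Finset.sum_subset (Finset.range_subset_range.2 (by omega : n - 1 - n / 2 - i ≤ n))]
      · refine Finset.sum_congr rfl fun k hk => ?_
        rw [Finset.mem_range] at hk
        rw [if_pos (by omega)]
      · intro k hk hk'
        rw [Finset.mem_range] at hk hk'
        rw [if_neg (by omega)]
    · intro i hi hi'
      rw [Finset.mem_range] at hi hi'
      refine Finset.sum_eq_zero fun j hj => ?_
      rw [Finset.mem_range] at hj
      rw [if_neg (by omega)]
  have hcorner' : ∑ i ∈ Finset.range n, ∑ j ∈ Finset.range n,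
      (if j + n / 2 < i then f i * f j else 0) =
      ∑ i ∈ Finset.range n, ∑ j ∈ Finset.range n, (if i + n / 2 < j then f i * f j else 0) := by
    rw [Finset.sum_comm]
    simp_rw [mul_comm (f _) (f _)]
  have hall : (∑ i ∈ Finset.range n, f i) ^ 2 =
      ∑ i ∈ Finset.range n, ∑ j ∈ Finset.range n, f i * f j := by
    rw [sq, Finset.sum_mul_sum]
  have hsplit : ∀ i j, (if i ≤ j + n / 2 ∧ j ≤ i + n / 2 then f i * f j else 0) =
      f i * f j - (if i + n / 2 < j then f i * f j else 0) -
        (if j + n / 2 < i then f i * f j else 0) := by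
    intro i j
    split_ifs <;> first | omega | ring
  simp_rw [hsplit, Finset.sum_sub_distrib]
  rw [hcorner', hcorner, hall]
  ring

/-- The model matrix is `p` times the difference of the full band and the identity; the band is
described by natural numbers. -/
theorem modelMatrix_apply (p : ℝ) {n : ℕ} (i j : Fin n) :
    modelMatrix p n i j =
      (if (i : ℕ) ≤ j + n / 2 ∧ (j : ℕ) ≤ i + n / 2 then p else 0) - if i = j then p else 0 := by
  have hiff : |((i : ℕ) : ℝ) - ((j : ℕ) : ℝ)| ≤ (n : ℝ) / 2 ↔
      (i : ℕ) ≤ j + n / 2 ∧ (j : ℕ) ≤ i + n / 2 := by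
    have h1 : ((i : ℕ) : ℝ) - ((j : ℕ) : ℝ) ≤ (n : ℝ) / 2 ↔ (i : ℕ) ≤ j + n / 2 := by
      rw [sub_le_iff_le_add, ← sub_le_iff_le_add, le_div_iff₀ two_pos]
      have : (((i : ℕ) : ℝ) - ((j : ℕ) : ℝ)) * 2 ≤ (n : ℝ) ↔ 2 * (i : ℕ) ≤ 2 * (j : ℕ) + n := by
        rw [← Nat.cast_le (α := ℝ)]
        push_cast
        constructor <;> intro h <;> linarith
      rw [this]
      omega
    have h2 : ((j : ℕ) : ℝ) - ((i : ℕ) : ℝ) ≤ (n : ℝ) / 2 ↔ (j : ℕ) ≤ i + n / 2 := by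
      rw [le_div_iff₀ two_pos]
      have : (((j : ℕ) : ℝ) - ((i : ℕ) : ℝ)) * 2 ≤ (n : ℝ) ↔ 2 * (j : ℕ) ≤ 2 * (i : ℕ) + n := by
        rw [← Nat.cast_le (α := ℝ)]
        push_cast
        constructor <;> intro h <;> linarith
      rw [this]
      omega
    rw [abs_le', neg_sub, h1, h2]
  simp only [modelMatrix, Matrix.of_apply, hiff]
  by_cases hij : i = j
  · subst hij
    simp
  · simp [hij]

theorem inner_modelMatrix_eq (p : ℝ) (n : ℕ) (f : ℕ → ℝ) :
    inner ℝ (WithLp.toLp 2 fun i : Fin n => f i)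
        (Matrix.toEuclideanLin (modelMatrix p n) (WithLp.toLp 2 fun i : Fin n => f i)) =
      p * ((∑ i ∈ Finset.range n, f i) ^ 2 -
        2 * ∑ i ∈ Finset.range (n - 1 - n / 2),
          f i * ∑ k ∈ Finset.range (n - 1 - n / 2 - i), f (n - 1 - k) -
        ∑ i ∈ Finset.range n, f i ^ 2) := by
  rw [← sum_band_eq, PiLp.inner_apply, mul_sub, Finset.sum_range fun i => f i ^ 2,
    Finset.sum_range fun i => ∑ j ∈ Finset.range n, _, Finset.mul_sum, Finset.mul_sum,
    ← Finset.sum_sub_distrib]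
  refine Finset.sum_congr rfl fun i _ => ?_
  simp only [Matrix.toEuclideanLin, Matrix.toLpLin_apply, Matrix.mulVec, dotProduct,
    RCLike.inner_apply, conj_trivial, modelMatrix_apply, sub_mul, Finset.sum_sub_distrib,
    ite_mul, zero_mul, Finset.sum_ite_eq, Finset.mem_univ, if_true]
  rw [Finset.sum_range fun j => if (i : ℕ) ≤ j + n / 2 ∧ j ≤ i + n / 2 then f i * f j else 0,
    Finset.sum_mul, Finset.mul_sum]
  congr 1
  · refine Finset.sum_congr rfl fun j _ => ?_
    split_ifs <;> ring
  · ring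

/-- The test vector `α + β (n - 1 - 2 i)`: a combination of the constant vector and of the
antisymmetric linear vector. -/
noncomputable def affineVector (n : ℕ) : ℝ × ℝ →ₗ[ℝ] EuclideanSpace ℝ (Fin n) where
  toFun c := WithLp.toLp 2 fun i : Fin n => c.1 + c.2 * ((n : ℝ) - 1 - 2 * ((i : ℕ) : ℝ))
  map_add' c d := by
    ext i
    simp only [Prod.fst_add, Prod.snd_add, PiLp.add_apply]
    ring
  map_smul' s c := by
    ext i
    simp only [Prod.smul_fst, Prod.smul_snd, PiLp.smul_apply, smul_eq_mul, RingHom.id_apply]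
    ring

theorem sum_affine (n q : ℕ) (α β : ℝ) :
    ∑ i ∈ Finset.range q, (α + β * ((n : ℝ) - 1 - 2 * (i : ℝ))) =
      α * q + β * (q * (n - q)) := by
  induction q with
  | zero => simp
  | succ q ih =>
    rw [Finset.sum_range_succ, ih]
    push_cast
    ring

theorem sum_affine_sq (n : ℕ) (α β : ℝ) :
    ∑ i ∈ Finset.range n, (α + β * ((n : ℝ) - 1 - 2 * (i : ℝ))) ^ 2 =
      α ^ 2 * n + β ^ 2 * (n * (n ^ 2 - 1) / 3) := by
  have h : ∀ q : ℕ, ∑ i ∈ Finset.range q, (α + β * ((n : ℝ) - 1 - 2 * (i : ℝ))) ^ 2 =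
      q * (α + β * (n - 1)) ^ 2 - 2 * (α + β * (n - 1)) * β * (q * (q - 1)) +
        4 * β ^ 2 * ((q - 1) * q * (2 * q - 1) / 6) := by
    intro q
    induction q with
    | zero => simp
    | succ q ih =>
      rw [Finset.sum_range_succ, ih]
      push_cast
      ring
  rw [h]
  ring

/-- The corner triangles seen by the test vector; the mixed term in `α` and `β` cancels. -/
theorem sum_affine_corner (n r : ℕ) (α β : ℝ) (hr : r ≤ n) :
    ∑ i ∈ Finset.range r, (α + β * ((n : ℝ) - 1 - 2 * (i : ℝ))) *
        ∑ k ∈ Finset.range (r - i), (α + β * ((n : ℝ) - 1 - 2 * ((n - 1 - k : ℕ) : ℝ))) =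
      α ^ 2 * (r * (r + 1) / 2) -
        β ^ 2 * ((n - 1 - 2 * r) * n * (r * (r + 1) / 2) +
          (n + 1 + 2 * r) * (r * (r + 1) * (2 * r + 1) / 6) - r ^ 2 * (r + 1) ^ 2 / 2) := by
  have hinner : ∀ i ∈ Finset.range r,
      ∑ k ∈ Finset.range (r - i), (α + β * ((n : ℝ) - 1 - 2 * ((n - 1 - k : ℕ) : ℝ))) =
        α * (r - i) - β * ((r - i) * (n - (r - i))) := by
    intro i hi
    rw [Finset.mem_range] at hi
    have hsum := sum_affine n (r - i) α (-β)
    rw [Nat.cast_sub hi.le] at hsum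
    rw [sub_eq_add_neg (α * _), ← neg_mul, ← hsum]
    refine Finset.sum_congr rfl fun k hk => ?_
    rw [Finset.mem_range] at hk
    rw [Nat.cast_sub (by omega), Nat.cast_sub (by omega)]
    push_cast
    ring
  -- The summands are polynomials in `q = r - i`, which runs through `1, …, r`.
  let h : ℝ → ℝ := fun q => (α + β * ((n - 1 - 2 * r : ℝ) + 2 * q)) * (α * q - β * (q * (n - q)))
  have hrefl : ∑ i ∈ Finset.range r, (α + β * ((n : ℝ) - 1 - 2 * (i : ℝ))) *
        ∑ k ∈ Finset.range (r - i), (α + β * ((n : ℝ) - 1 - 2 * ((n - 1 - k : ℕ) : ℝ))) =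
      ∑ q ∈ Finset.range r, h (q + 1) := by
    rw [← Finset.sum_range_reflect fun q : ℕ => h (q + 1)]
    refine Finset.sum_congr rfl fun i hi => ?_
    rw [hinner i hi]
    rw [Finset.mem_range] at hi
    rw [Nat.cast_sub (by omega), Nat.cast_sub (by omega)]
    simp only [h]
    push_cast
    ring
  have hclosed : ∀ (c : ℝ) (m : ℕ), ∑ q ∈ Finset.range m,
      (α + β * (c + 2 * ((q : ℝ) + 1))) * (α * (q + 1) - β * ((q + 1) * (n - (q + 1)))) =
      α ^ 2 * (m * (m + 1) / 2) +
        α * β * ((c - n) * (m * (m + 1) / 2) + 3 * (m * (m + 1) * (2 * m + 1) / 6)) -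
        β ^ 2 * (c * n * (m * (m + 1) / 2) + (2 * n - c) * (m * (m + 1) * (2 * m + 1) / 6) -
          2 * (m ^ 2 * (m + 1) ^ 2 / 4)) := by
    intro c m
    induction m with
    | zero => simp
    | succ m ih =>
      rw [Finset.sum_range_succ, ih]
      push_cast
      ring
  rw [hrefl]
  simp only [h]
  rw [hclosed]
  ring

theorem norm_affineVector_sq (n : ℕ) (c : ℝ × ℝ) :
    ‖affineVector n c‖ ^ 2 = c.1 ^ 2 * n + c.2 ^ 2 * (n * (n ^ 2 - 1) / 3) := by
  rw [EuclideanSpace.real_norm_sq_eq, ← sum_affine_sq, Finset.sum_range]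
  rfl

theorem inner_modelMatrix_affineVector (p : ℝ) {n : ℕ} (c : ℝ × ℝ) {r : ℕ}
    (hr : r = n - 1 - n / 2) :
    inner ℝ (affineVector n c) (Matrix.toEuclideanLin (modelMatrix p n) (affineVector n c)) =
      p * (c.1 ^ 2 * (n ^ 2 - r * (r + 1) - n) +
        c.2 ^ 2 * (2 * ((n - 1 - 2 * r) * n * (r * (r + 1) / 2) +
          (n + 1 + 2 * r) * (r * (r + 1) * (2 * r + 1) / 6) - r ^ 2 * (r + 1) ^ 2 / 2) -
            n * (n ^ 2 - 1) / 3)) := by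
  have h := inner_modelMatrix_eq p n fun i => c.1 + c.2 * ((n : ℝ) - 1 - 2 * (i : ℝ))
  rw [sum_affine, sum_affine_sq, ← hr, sum_affine_corner n r c.1 c.2 (by omega)] at h
  refine Eq.trans h ?_
  ring

/-- The squared Frobenius norm is the quadratic form, with `p ^ 2` in place of `p`, at the constant
vector. -/
theorem sum_modelMatrix_sq_le {p : ℝ} (n : ℕ) :
    ∑ i, ∑ j, modelMatrix p n i j ^ 2 ≤ 3 / 4 * (p * n) ^ 2 := by
  have h1 : ∑ i, ∑ j, modelMatrix p n i j ^ 2 =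
      inner ℝ (affineVector n (1, 0))
        (Matrix.toEuclideanLin (modelMatrix (p ^ 2) n) (affineVector n (1, 0))) := by
    rw [PiLp.inner_apply]
    refine Finset.sum_congr rfl fun i _ => ?_
    simp only [Matrix.toEuclideanLin, Matrix.toLpLin_apply, Matrix.mulVec, dotProduct,
      RCLike.inner_apply, conj_trivial, affineVector, LinearMap.coe_mk, AddHom.coe_mk, zero_mul,
      add_zero, mul_one]
    refine Finset.sum_congr rfl fun j _ => ?_
    simp only [modelMatrix, Matrix.of_apply, ite_pow]
    simp
  rw [h1, inner_modelMatrix_affineVector (p ^ 2) (1, 0) rfl]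
  have h2 : ((n : ℝ) ^ 2 - ((n - 1 - n / 2 : ℕ) : ℝ) * (((n - 1 - n / 2 : ℕ) : ℝ) + 1) - n) ≤
      3 / 4 * (n : ℝ) ^ 2 := by
    set r := n - 1 - n / 2 with hr
    have hcases : n = 0 ∨ n = 2 * r + 1 ∨ n = 2 * r + 2 := by omega
    rcases hcases with h | h | h
    · simp [hr, h]
    · rw [h]
      push_cast
      nlinarith
    · rw [h]
      push_cast
      nlinarith [(Nat.cast_nonneg r : (0 : ℝ) ≤ r)]
  have h3 := mul_le_mul_of_nonneg_left h2 (sq_nonneg p)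
  nlinarith

/-- The quadratic form of the model matrix at the constant vector, and at the antisymmetric linear
vector. In the scaling limit the two Rayleigh quotients are `3/4` and `5/16` times `p n`. -/
theorem modelMatrix_rayleigh_bounds {n r : ℕ} (hn : 100000 ≤ n) (hr : r = n - 1 - n / 2) :
    7499 / 10000 * (n : ℝ) * n < n ^ 2 - r * (r + 1) - n ∧
    31 / 100 * (n : ℝ) * (n * (n ^ 2 - 1) / 3) <
      2 * ((n - 1 - 2 * r) * n * (r * (r + 1) / 2) +
          (n + 1 + 2 * r) * (r * (r + 1) * (2 * r + 1) / 6) - r ^ 2 * (r + 1) ^ 2 / 2) -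
            n * (n ^ 2 - 1) / 3 := by
  -- In terms of `s = r - 49999` the differences of the two sides have positive coefficients.
  obtain ⟨s, rfl⟩ : ∃ s, r = s + 49999 := ⟨r - 49999, by omega⟩
  have hs : (0 : ℝ) ≤ s := Nat.cast_nonneg s
  have hcases : n = 2 * (s + 49999) + 1 ∨ n = 2 * (s + 49999) + 2 := by omega
  rcases hcases with rfl | rfl
  · push_cast
    constructor
    · rw [← sub_pos]
      ring_nf
      positivity
    · rw [← sub_pos]
      ring_nf
      positivity
  · push_cast
    constructor
    · rw [← sub_pos]
      ring_nf
      positivity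
    · rw [← sub_pos]
      ring_nf
      positivity

/-- The spectral picture of the model matrix: two eigenvalues are located by test vectors, and
the Frobenius norm leaves too little room for any other eigenvalue to be near them. -/
theorem exists_modelMatrix_eigenvalues {p : ℝ} (hp : 0 < p) {n : ℕ} (hn : 100000 ≤ n) :
    ∃ i₀ i₁ : Fin n, i₀ ≠ i₁ ∧
      7499 / 10000 * (p * n) < (modelMatrix_isHermitian p n).eigenvalues i₀ ∧
      (modelMatrix_isHermitian p n).eigenvalues i₁ ∈
        Set.Ioc (31 / 100 * (p * n)) (44 / 100 * (p * n)) ∧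
      ∀ i, i ≠ i₀ → i ≠ i₁ →
        |(modelMatrix_isHermitian p n).eigenvalues i| ≤ 304 / 1000 * (p * n) := by
  classical
  obtain ⟨hb1, hb2⟩ := modelMatrix_rayleigh_bounds hn rfl
  set hM := modelMatrix_isHermitian p n
  have hn0 : (100000 : ℝ) ≤ n := by exact_mod_cast hn
  have hpn : 0 < p * n := by positivity
  have hone : Module.finrank ℝ ℝ ≤
      (Finset.univ.filter fun i => 7499 / 10000 * (p * n) < hM.eigenvalues i).card := by
    refine finrank_le_card_eigenvalues_gt hM
      ((affineVector n).comp (LinearMap.inl ℝ ℝ ℝ)) fun c hc => ?_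
    rw [LinearMap.comp_apply, inner_modelMatrix_affineVector p _ rfl, norm_affineVector_sq]
    simp only [LinearMap.inl_apply]
    have h1 := mul_lt_mul_of_pos_left hb1 (mul_pos hp (sq_pos_of_ne_zero hc))
    nlinarith
  have htwo : Module.finrank ℝ (ℝ × ℝ) ≤
      (Finset.univ.filter fun i => 31 / 100 * (p * n) < hM.eigenvalues i).card := by
    refine finrank_le_card_eigenvalues_gt hM (affineVector n) fun c hc => ?_
    rw [inner_modelMatrix_affineVector p _ rfl, norm_affineVector_sq]
    have hb1' : 31 / 100 * (n : ℝ) * n < n ^ 2 -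
        ((n - 1 - n / 2 : ℕ) : ℝ) * (((n - 1 - n / 2 : ℕ) : ℝ) + 1) - n := by nlinarith
    have hc' : c.1 ≠ 0 ∨ c.2 ≠ 0 := by
      by_contra! h
      exact hc (Prod.ext h.1 h.2)
    rw [← mul_assoc, mul_comm (31 / 100) p, mul_assoc p, mul_assoc p]
    refine mul_lt_mul_of_pos_left ?_ hp
    rw [mul_add, mul_left_comm, mul_left_comm _ (c.2 ^ 2)]
    rcases hc' with h | h
    · exact add_lt_add_of_lt_of_le (mul_lt_mul_of_pos_left hb1' (sq_pos_of_ne_zero h))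
        (mul_le_mul_of_nonneg_left hb2.le (sq_nonneg _))
    · exact add_lt_add_of_le_of_lt (mul_le_mul_of_nonneg_left hb1'.le (sq_nonneg _))
        (mul_lt_mul_of_pos_left hb2 (sq_pos_of_ne_zero h))
  rw [Module.finrank_self] at hone
  rw [Module.finrank_prod, Module.finrank_self] at htwo
  obtain ⟨i₀, hi₀⟩ := Finset.card_pos.1 hone
  obtain ⟨i₁, hi₁, hne⟩ := Finset.exists_mem_ne htwo i₀
  have h0 := (Finset.mem_filter.1 hi₀).2
  have h1 := (Finset.mem_filter.1 hi₁).2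
  have hfrob : ∑ i, hM.eigenvalues i ^ 2 ≤ 3 / 4 * (p * n) ^ 2 := by
    rw [sum_eigenvalues_sq]
    exact sum_modelMatrix_sq_le n
  have hpair : hM.eigenvalues i₀ ^ 2 + hM.eigenvalues i₁ ^ 2 ≤ 3 / 4 * (p * n) ^ 2 := by
    refine le_trans ?_ hfrob
    rw [← Finset.sum_pair (f := fun i => hM.eigenvalues i ^ 2) hne.symm]
    exact Finset.sum_le_sum_of_subset_of_nonneg (Finset.subset_univ _) fun _ _ _ => sq_nonneg _
  have hsq0 : (7499 / 10000 * (p * n)) ^ 2 ≤ hM.eigenvalues i₀ ^ 2 := by gcongr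
  have hsq1 : (31 / 100 * (p * n)) ^ 2 ≤ hM.eigenvalues i₁ ^ 2 := by gcongr
  refine ⟨i₀, i₁, hne.symm, h0, ⟨h1, ?_⟩, fun i hi0 hi1 => ?_⟩
  · refine (abs_le_of_sq_le_sq' ?_ (by positivity)).2
    nlinarith
  · have htriple : hM.eigenvalues i ^ 2 + (hM.eigenvalues i₀ ^ 2 + hM.eigenvalues i₁ ^ 2) ≤
        3 / 4 * (p * n) ^ 2 := by
      refine le_trans ?_ hfrob
      rw [← Finset.sum_pair (f := fun i => hM.eigenvalues i ^ 2) hne.symm,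
        ← Finset.sum_insert (f := fun i => hM.eigenvalues i ^ 2) (by simp [hi0, hi1])]
      exact Finset.sum_le_sum_of_subset_of_nonneg (Finset.subset_univ _) fun _ _ _ => sq_nonneg _
    refine abs_le_of_sq_le_sq ?_ (by positivity)
    nlinarith

end Model

/-! ### Comparison of the eigenvectors -/

theorem min_norm_sub_norm_add_le_of_common {E : Type*} [NormedAddCommGroup E]
    {e x y : E} {ε : ℝ} (hx : min ‖e - x‖ ‖e + x‖ ≤ ε) (hy : min ‖e - y‖ ‖e + y‖ ≤ ε) :
    min ‖x - y‖ ‖x + y‖ ≤ 2 * ε := by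
  rcases min_le_iff.1 hx with hx | hx <;> rcases min_le_iff.1 hy with hy | hy
  · refine (min_le_left _ _).trans ?_
    have h : x - y = (e - y) - (e - x) := by abel
    rw [h]
    linarith [norm_sub_le (e - y) (e - x)]
  · refine (min_le_right _ _).trans ?_
    have h : x + y = (e + y) - (e - x) := by abel
    rw [h]
    linarith [norm_sub_le (e + y) (e - x)]
  · refine (min_le_right _ _).trans ?_
    have h : x + y = (e + x) - (e - y) := by abel
    rw [h]
    linarith [norm_sub_le (e + x) (e - y)]
  · refine (min_le_left _ _).trans ?_
    have h : x - y = (e + x) - (e + y) := by abel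
    rw [h]
    linarith [norm_sub_le (e + x) (e + y)]

/-- The deterministic part: a perturbation of the model matrix of norm `12 √n` moves the unit
eigenvectors for `λ₂` by `O(n ^ (-1/2))`, because the gaps around `λ₂` are of order `p n`. -/
theorem min_norm_sub_norm_add_le_of_near_modelMatrix {p : ℝ} (hp0 : 0 < p) (hp1 : p ≤ 1) {n : ℕ}
    (hn : 6000 / p ≤ √n) {key : ℝ → ℝ} (hkey : key = id ∨ key = fun t => |t|)
    {B : Matrix (Fin n) (Fin n) ℝ} (hB : B.IsHermitian)
    (hnear : ∀ v, ‖Matrix.toEuclideanLin (B - modelMatrix p n) v‖ ≤ 12 * √n * ‖v‖)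
    {x y : EuclideanSpace ℝ (Fin n)} (hx : IsSecondUnitEigenvector key (modelMatrix p n) x)
    (hy : IsSecondUnitEigenvector key B y) :
    min ‖x - y‖ ‖x + y‖ ≤ 24000 / p / √n := by
  have hsqrt : (6000 : ℝ) ≤ √n := by
    refine le_trans ?_ hn
    rw [le_div_iff₀ hp0]
    linarith
  have hnsq : √(n : ℝ) ^ 2 = n := Real.sq_sqrt (Nat.cast_nonneg n)
  have hn' : 100000 ≤ n := by
    have : (100000 : ℝ) ≤ n := by nlinarith
    exact_mod_cast this
  have hpos : 0 < √(n : ℝ) := by linarith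
  obtain ⟨i₀, i₁, hi, h₀, h₁, hrest⟩ := exists_modelMatrix_eigenvalues hp0 hn'
  have hpn : 0 < p * n := by
    rw [← hnsq]
    positivity
  have hηδ : 12 * √(n : ℝ) ≤ 2 / 1000 * (p * n) := by
    rw [div_le_iff₀ hp0] at hn
    nlinarith
  have hM := modelMatrix_isHermitian p n
  have hzero : ∀ v, ‖Matrix.toEuclideanLin (modelMatrix p n - modelMatrix p n) v‖ ≤
      12 * √n * ‖v‖ := by
    intro v
    rw [sub_self, map_zero, LinearMap.zero_apply, norm_zero]
    positivity
  have hex := hx.min_norm_eigenvectorBasis_sub_le hkey hM hM hi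
    (δ := 2 / 1000 * (p * n)) (by positivity) (by positivity) hηδ
    (by linarith) (by linarith) h₀ h₁ hrest (by positivity) hzero
  have hey := hy.min_norm_eigenvectorBasis_sub_le hkey hM hB hi
    (δ := 2 / 1000 * (p * n)) (by positivity) (by positivity) hηδ
    (by linarith) (by linarith) h₀ h₁ hrest (by positivity) hnear
  refine (min_norm_sub_norm_add_le_of_common hex hey).trans (le_of_eq ?_)
  nth_rewrite 2 [← hnsq]
  field_simp
  norm_num

theorem theorem1 (p : ℝ) (hp0 : 0 < p) (hp1 : p ≤ 1) :
    ∃ C₀ : ℝ, 0 < C₀ ∧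
      ∀ (n : ℕ), 2 ≤ n →
      ∀ (Ω : Type*) [MeasurableSpace Ω] (P : Measure Ω) [IsProbabilityMeasure P]
        (G : Ω → SimpleGraph (Fin n)), IsRandomLinearGraph P p G →
      ∀ key : ℝ → ℝ, (key = id ∨ key = fun t => |t|) →
        1 - (n : ℝ) ^ (-3 : ℤ) ≤
          P.real {ω | ∀ x y : EuclideanSpace ℝ (Fin n),
            IsSecondUnitEigenvector key (modelMatrix p n) x →
            IsSecondUnitEigenvector key (adjacencyMatrix (G ω)) y →
            min ‖x - y‖ ‖x + y‖ ≤ C₀ * (n : ℝ) ^ (-(1 / 2) : ℝ)} := by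
  refine ⟨24000 / p, by positivity, ?_⟩
  intro n hn Ω _ P _ G hG key hkey
  refine (hG.one_sub_le_measureReal_norm_le (by omega)).trans (measureReal_mono ?_)
  intro ω hω x y hx hy
  have hrpow : 24000 / p * (n : ℝ) ^ (-(1 / 2) : ℝ) = 24000 / p / √n := by
    rw [Real.rpow_neg (Nat.cast_nonneg n), ← Real.sqrt_eq_rpow, div_eq_mul_inv (24000 / p)]
  rw [hrpow]
  rcases le_total (6000 / p) √n with h | h
  · exact min_norm_sub_norm_add_le_of_near_modelMatrix hp0 hp1 h hkey
      (adjacencyMatrix_isHermitian _) hω hx hy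
  -- For small `n` the trivial bound `‖x - y‖ ≤ 2` suffices.
  · have hpos : 0 < √(n : ℝ) := Real.sqrt_pos.2 (by exact_mod_cast (by omega : 0 < n))
    refine (min_le_left _ _).trans ?_
    have h2 : ‖x - y‖ ≤ 2 := (norm_sub_le x y).trans (by rw [hx.1, hy.1]; norm_num)
    refine h2.trans ?_
    rw [le_div_iff₀ hpos]
    have h3 : 24000 / p = 4 * (6000 / p) := by ring
    rw [h3]
    linarith
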